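/- All graphs are finite, simple and undirected. For a graph $G$ let $F(G)$ be the core index of $G$, i.e. the number of connected subgraphs of $G$ (subgraphs have at least one vertex and need not be induced). A pendant vertex is a vertex of degree $1$. For integers $a,b\ge 1$ and $d\ge 1$ let $T(a,b,d)$ be the tree on $a+b+d$ vertices obtained from the path $P_d=v_1v_2\cdots v_d$ by adding $a$ pendant vertices adjacent to $v_1$ and $b$ pendant vertices adjacent to $v_d$. Let $n,k$ be integers with $2\le k\le n-2$, and let $G$ be a connected graph on $n$ vertices with exactly $k$ pendant vertices. Then $$F(G)\ \ge\ F\bigl(T(\lfloor k/2\rfloor,\lceil k/2\rceil,n-k)\bigr),$$ and equality holds if and only if $G$ is isomorphic to $T(\lfloor k/2\rfloor,\lceil k/2\rceil,n-k)$. -/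

import Mathlib

/-- The core index `F(G)`: the number of connected subgraphs of `G`. Subgraphs are arbitrary
(a set of vertices together with a set of edges of `G` between them, not necessarily induced),
and a connected subgraph has at least one vertex by definition. For finite `G` there are only
finitely many subgraphs. -/
noncomputable def coreIndex {V : Type*} (G : SimpleGraph V) : ℕ :=
  Nat.card {H : G.Subgraph // H.Connected}

/-- The adjacency relation of the tree `T(a, b, d)`: the vertices `Sum.inl i` with `i : Fin d` form
the path `P_d`, each of the `a` vertices `Sum.inr (Sum.inl _)` is joined only to the first vertex of
the path, and each of the `b` vertices `Sum.inr (Sum.inr _)` is joined only to its last vertex. -/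
def doubleBroomAdj (a b d : ℕ) : Fin d ⊕ (Fin a ⊕ Fin b) → Fin d ⊕ (Fin a ⊕ Fin b) → Prop
  | Sum.inl i, Sum.inl j => i.val + 1 = j.val ∨ j.val + 1 = i.val
  | Sum.inl i, Sum.inr (Sum.inl _) => i.val = 0
  | Sum.inl i, Sum.inr (Sum.inr _) => i.val + 1 = d
  | Sum.inr (Sum.inl _), Sum.inl j => j.val = 0
  | Sum.inr (Sum.inr _), Sum.inl j => j.val + 1 = d
  | Sum.inr _, Sum.inr _ => False

/-- The tree `T(a, b, d)`: the path `P_d` with vertices `v_1, …, v_d` in this order, `a` pendant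
vertices attached to `v_1` and `b` pendant vertices attached to `v_d` (for `d ≥ 1`). -/
def doubleBroom (a b d : ℕ) : SimpleGraph (Fin d ⊕ (Fin a ⊕ Fin b)) where
  Adj := doubleBroomAdj a b d
  symm := ⟨by
    rintro (i | i | i) (j | j | j) h <;> simp only [doubleBroomAdj] at h ⊢ <;> tauto⟩
  loopless := ⟨by
    rintro (i | i | i) h <;> simp only [doubleBroomAdj] at h
    omega⟩

/-! Let `T` be a spanning tree of `G`. Each vertex set connected in `T` yields a connected subgraph
of `G` on the same vertices, and if `T ≠ G` then `G` itself is one more. So it suffices to bound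
from below the number of connected vertex sets of a tree.

Call an edge inner if neither end is pendant, and sort the connected sets `S` containing a
non-pendant vertex by their inner boundary, the inner edges with exactly one end in `S`. Deleting
leaves never changes this boundary. With `L` leaves, the empty boundary therefore occurs at least
`2^L` times; a boundary `{e}` at least `2^x + 2^(L-x)` times, where `x` leaves lie on one side of
`e`, which is least when balanced; a boundary `{e, f}` at least once. Adding the `L` leaf singletons
gives `broomCount L m` for `m` inner edges (`IsTree.broomCount_le`), and an encoding shows that the
balanced broom has at most that many (`coreIndex_doubleBroom_le`). Passing to `T` may create leaves,
but `L + m = n - 1` is fixed, and trading an inner edge for a leaf does not lower the count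
(`broomCount_add_le`).

Equality forces `T = G` and every fiber to have its minimal size. Then a vertex with two non-pendant
neighbours has no third neighbour (`eq_or_eq_of_tight`), so the non-pendant vertices form a path
with all leaves at its ends (`IsTree.exists_isSpine`); tightness at an end edge of this path
balances the leaves. -/

namespace SimpleGraph

open Finset

/-! ### Connected subgraphs and connected vertex sets -/

/-- A connected subgraph meeting a vertex set and its complement has an edge crossing it. -/
lemma Subgraph.Connected.exists_adj_crossing {V : Type*} {G : SimpleGraph V} {H : G.Subgraph}
    (hH : H.Connected) (C : Set V) {x y : V} (hx : x ∈ H.verts) (hy : y ∈ H.verts)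
    (hxC : x ∈ C) (hyC : y ∉ C) : ∃ u v, H.Adj u v ∧ u ∈ C ∧ v ∉ C := by
  obtain ⟨p⟩ := hH.coe.preconnected ⟨x, hx⟩ ⟨y, hy⟩
  obtain ⟨d, -, h1, h2⟩ := p.exists_boundary_dart (Subtype.val ⁻¹' C) hxC hyC
  exact ⟨d.fst, d.snd, d.adj, h1, h2⟩

lemma coreIndex_le_of_iso {V W : Type*} [Finite W] {G : SimpleGraph V} {G' : SimpleGraph W}
    (e : G ≃g G') : coreIndex G ≤ coreIndex G' := by
  let F : {H : G.Subgraph // H.Connected} → {H : G'.Subgraph // H.Connected} := fun H =>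
    ⟨H.1.map e.toHom, by
      rw [Subgraph.connected_iff]
      refine ⟨?_, by simpa using H.2.nonempty⟩
      rw [Subgraph.preconnected_iff]
      rintro ⟨_, u, hu, rfl⟩ ⟨_, v, hv, rfl⟩
      let φ : H.1.coe →g (H.1.map e.toHom).coe :=
        ⟨fun x => ⟨e x, x, x.2, rfl⟩, fun {a b} h => ⟨a, b, h, rfl, rfl⟩⟩
      exact (H.2.coe.preconnected ⟨u, hu⟩ ⟨v, hv⟩).map φ⟩
  refine Nat.card_le_card_of_injective F fun H K h => ?_
  have h' : (H.1.map e.toHom).map e.symm.toHom = (K.1.map e.toHom).map e.symm.toHom := by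
    rw [show H.1.map e.toHom = K.1.map e.toHom from congrArg Subtype.val h]
  rw [← Subgraph.map_comp, ← Subgraph.map_comp] at h'
  have he : e.symm.toHom.comp e.toHom = Hom.id := by
    ext x
    exact e.symm_apply_apply x
  rw [he, Subgraph.map_id, Subgraph.map_id] at h'
  exact Subtype.ext h'

lemma coreIndex_eq_of_iso {V W : Type*} [Finite V] [Finite W] {G : SimpleGraph V}
    {G' : SimpleGraph W} (e : G ≃g G') : coreIndex G = coreIndex G' :=
  le_antisymm (coreIndex_le_of_iso e) (coreIndex_le_of_iso e.symm)

open Classical in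
/-- The vertex sets that induce a connected subgraph. -/
noncomputable def connSets {V : Type*} [Fintype V] (T : SimpleGraph V) : Finset (Finset V) :=
  univ.filter fun S => (T.induce (S : Set V)).Connected

lemma mem_connSets {V : Type*} [Fintype V] {T : SimpleGraph V} {S : Finset V} :
    S ∈ connSets T ↔ (T.induce (S : Set V)).Connected := by
  simp [connSets]

/-- The subgraph of `G` induced on `S` by a spanning subgraph `T` of `G`. -/
def subgraphOn {V : Type*} {T G : SimpleGraph V} (h : T ≤ G) (S : Set V) : G.Subgraph where
  verts := S
  Adj u v := T.Adj u v ∧ u ∈ S ∧ v ∈ S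
  adj_sub h' := h h'.1
  edge_vert h' := h'.2.1
  symm := ⟨fun _ _ h' => ⟨h'.1.symm, h'.2.2, h'.2.1⟩⟩

lemma subgraphOn_connected {V : Type*} {T G : SimpleGraph V} (h : T ≤ G) {S : Set V}
    (hS : (T.induce S).Connected) : (subgraphOn h S).Connected := by
  refine ⟨?_⟩
  have : T.induce S ≤ (subgraphOn h S).coe := fun u v huv => ⟨huv, u.2, v.2⟩
  exact hS.mono this

lemma card_connSets_le {V : Type*} [Fintype V] {T G : SimpleGraph V} (h : T ≤ G) :
    (connSets T).card ≤ coreIndex G := by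
  rw [← Nat.card_eq_finsetCard]
  let F : connSets T → {H : G.Subgraph // H.Connected} := fun S =>
    ⟨subgraphOn h S.1, subgraphOn_connected h (mem_connSets.1 S.2)⟩
  refine Nat.card_le_card_of_injective F fun S S' hSS => ?_
  have := congrArg (fun H : {H : G.Subgraph // H.Connected} => H.1.verts) hSS
  exact Subtype.ext (Finset.coe_injective this)

/-- The whole of `G` uses an edge outside `T`, so it is missed by `subgraphOn`; `none` is sent to
it. -/
lemma card_connSets_lt {V : Type*} [Fintype V] {T G : SimpleGraph V} (h : T ≤ G) (hne : T ≠ G)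
    (hG : G.Connected) : (connSets T).card < coreIndex G := by
  have : (connSets T).card + 1 = Nat.card (Option (connSets T)) := by
    rw [Finite.card_option, Nat.card_eq_finsetCard]
  rw [← Nat.succ_le_iff, Nat.succ_eq_add_one, this]
  have htop : (⊤ : G.Subgraph).Connected := by
    rw [Subgraph.connected_iff']
    exact (Subgraph.topIso (G := G)).connected_iff.2 hG
  let F : Option (connSets T) → {H : G.Subgraph // H.Connected} := fun S =>
    S.elim ⟨⊤, htop⟩ fun S => ⟨subgraphOn h S.1, subgraphOn_connected h (mem_connSets.1 S.2)⟩
  have key : ∀ S : Set V, (⊤ : G.Subgraph) ≠ subgraphOn h S := by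
    intro S hS
    refine hne (le_antisymm h fun u v huv => ?_)
    have h1 : (⊤ : G.Subgraph).Adj u v := huv
    rw [hS] at h1
    exact h1.1
  refine Nat.card_le_card_of_injective F ?_
  rintro (_ | S) (_ | S') hSS
  · rfl
  · exact absurd (congrArg Subtype.val hSS) (key _)
  · exact absurd (congrArg Subtype.val hSS).symm (key _)
  · have := congrArg (fun H : {H : G.Subgraph // H.Connected} => H.1.verts) hSS
    exact congrArg some (Subtype.ext (Finset.coe_injective this))

/-! ### Path-closed sets and one-edge cuts -/

/-- A set of vertices is path-closed if it contains every path between two of its vertices. -/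
def PathClosed {V : Type*} (T : SimpleGraph V) (S : Set V) : Prop :=
  ∀ ⦃u v : V⦄ (p : T.Walk u v), p.IsPath → u ∈ S → v ∈ S → ∀ w ∈ p.support, w ∈ S

lemma PathClosed.inter {V : Type*} {T : SimpleGraph V} {S S' : Set V} (h : T.PathClosed S)
    (h' : T.PathClosed S') : T.PathClosed (S ∩ S') :=
  fun _ _ p hp hu hv w hw => ⟨h p hp hu.1 hv.1 w hw, h' p hp hu.2 hv.2 w hw⟩

lemma PathClosed.connected {V : Type*} {T : SimpleGraph V} (hT : T.Connected) {S : Set V}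
    (h : T.PathClosed S) (hS : S.Nonempty) : (T.induce S).Connected := by
  obtain ⟨u, hu⟩ := hS
  refine induce_connected_of_patches u hu fun {v} hv => ?_
  obtain ⟨p, hp⟩ := hT.exists_isPath u v
  exact ⟨{w | w ∈ p.support}, h p hp hu hv, p.start_mem_support, p.end_mem_support,
    p.connected_induce_support.preconnected _ _⟩

/-- The edge `e` is the only edge joining `C` to its complement. -/
def IsCut {V : Type*} (T : SimpleGraph V) (e : Sym2 V) (C : Set V) : Prop :=
  ∀ ⦃x y : V⦄, T.Adj x y → (¬(x ∈ C ↔ y ∈ C) ↔ s(x, y) = e)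

lemma IsCut.compl {V : Type*} {T : SimpleGraph V} {e : Sym2 V} {C : Set V} (h : T.IsCut e C) :
    T.IsCut e Cᶜ := fun x y hxy => by
  rw [← h hxy]
  simp only [Set.mem_compl_iff]
  tauto

/-- A path that leaves `C` and returns would traverse `e` twice. -/
lemma pathClosed_of_crossing {V : Type*} {T : SimpleGraph V} {C : Set V} {e : Sym2 V}
    (h : ∀ ⦃x y⦄, T.Adj x y → x ∈ C → y ∉ C → s(x, y) = e) : T.PathClosed C := by
  classical
  intro u v p hp hu hv w hw
  by_contra hwC
  obtain ⟨d, hd, h1, h2⟩ := (p.takeUntil w hw).exists_boundary_dart C hu hwC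
  obtain ⟨d', hd', h1', h2'⟩ := (p.dropUntil w hw).exists_boundary_dart Cᶜ hwC (by simpa using hv)
  have e1 : d.edge ∈ (p.takeUntil w hw).edges := List.mem_map_of_mem hd
  have e2 : d'.edge ∈ (p.dropUntil w hw).edges := List.mem_map_of_mem hd'
  have f1 : d.edge = e := h d.adj h1 h2
  have f2 : d'.edge = e := by
    have := h d'.adj.symm (by simpa using h2') h1'
    rw [Sym2.eq_swap] at this
    exact this
  have hn := hp.isTrail.edges_nodup
  rw [← p.take_spec hw, Walk.edges_append] at hn
  exact (List.nodup_append.1 hn).2.2 _ e1 _ e2 (f1.trans f2.symm)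

lemma IsCut.pathClosed {V : Type*} {T : SimpleGraph V} {e : Sym2 V} {C : Set V}
    (h : T.IsCut e C) : T.PathClosed C :=
  pathClosed_of_crossing fun _ _ hxy hx hy => (h hxy).1 (by tauto)

lemma IsAcyclic.exists_isCut {V : Type*} {T : SimpleGraph V} (hT : T.IsAcyclic) {u v : V}
    (huv : T.Adj u v) : ∃ C : Set V, u ∈ C ∧ v ∉ C ∧ T.IsCut s(u, v) C := by
  have hb := isAcyclic_iff_forall_adj_isBridge.1 hT huv
  rw [isBridge_iff] at hb
  -- In a forest every edge is a bridge; the cut is the component of `u` once the edge is deleted.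
  refine ⟨{w | (T.deleteEdges {s(u, v)}).Reachable u w}, Reachable.refl u, hb, ?_⟩
  intro x y hxy
  simp only [Set.mem_ofPred_eq]
  constructor
  · intro h
    by_contra hne
    have ha : (T.deleteEdges {s(u, v)}).Adj x y := by
      simpa [deleteEdges_adj, hxy] using hne
    exact h ⟨fun h => h.trans ha.reachable, fun h => h.trans ha.symm.reachable⟩
  · intro h h'
    rcases Sym2.eq_iff.1 h with ⟨rfl, rfl⟩ | ⟨rfl, rfl⟩
    · exact hb (h'.1 (Reachable.refl _))
    · exact hb (h'.2 (Reachable.refl _))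

end SimpleGraph

namespace SimpleGraph

open Finset

/-! ### Inner edges, and connected sets sorted by inner boundary -/

section Tree

open Classical

variable {V : Type*} {T : SimpleGraph V}

/-- A pendant vertex: one with exactly one neighbour. -/
def IsPendant (T : SimpleGraph V) (v : V) : Prop := ∃! w, T.Adj v w

lemma IsPendant.pathClosed_compl {v : V} (h : T.IsPendant v) : T.PathClosed {v}ᶜ := by
  obtain ⟨w, -, hu⟩ := h
  refine pathClosed_of_crossing (e := s(w, v)) fun x y hxy _ hy => ?_
  obtain rfl : y = v := by simpa using hy
  rw [hu x hxy.symm]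

/-- Two adjacent pendant vertices would form a whole component, leaving no room for a third vertex.
-/
lemma not_adj_of_isPendant [Fintype V] (hT : T.Connected) (hV : 3 ≤ Fintype.card V) {u v : V}
    (hu : T.IsPendant u) (hv : T.IsPendant v) : ¬T.Adj u v := by
  intro huv
  obtain ⟨w, hw⟩ : ∃ w, w ∉ ({u, v} : Finset V) := by
    by_contra! h
    have h1 : (univ : Finset V).card ≤ ({u, v} : Finset V).card := card_le_card fun x _ => h x
    have h2 := card_le_two (a := u) (b := v)
    rw [card_univ] at h1
    omega
  obtain ⟨p⟩ := hT.preconnected u w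
  obtain ⟨d, -, h1, h2⟩ := p.exists_boundary_dart {x | x = u ∨ x = v} (Or.inl rfl)
    (by simpa using hw)
  simp only [Set.mem_ofPred_eq] at h1 h2
  rcases h1 with h1 | h1
  · exact h2 (Or.inr (hu.unique (h1 ▸ d.adj) huv))
  · exact h2 (Or.inl (hv.unique (h1 ▸ d.adj) huv.symm))

variable [Fintype V]

/-- The set of pendant vertices. -/
noncomputable def leafSet (T : SimpleGraph V) : Finset V := univ.filter T.IsPendant

@[simp] lemma mem_leafSet {v : V} : v ∈ T.leafSet ↔ T.IsPendant v := by simp [leafSet]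

/-- The edges without pendant endpoints. -/
noncomputable def innerEdges (T : SimpleGraph V) : Finset (Sym2 V) :=
  univ.filter fun e => e ∈ T.edgeSet ∧ ∀ v ∈ e, ¬T.IsPendant v

lemma mk_mem_innerEdges {u v : V} :
    s(u, v) ∈ T.innerEdges ↔ T.Adj u v ∧ ¬T.IsPendant u ∧ ¬T.IsPendant v := by
  simp [innerEdges]

/-- The edges without pendant endpoints that have exactly one endpoint in `S`. -/
noncomputable def innerBoundary (T : SimpleGraph V) (S : Finset V) : Finset (Sym2 V) :=
  T.innerEdges.filter fun e => (∃ u ∈ e, u ∈ S) ∧ ∃ u ∈ e, u ∉ S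

lemma mk_mem_innerBoundary {S : Finset V} {u v : V} :
    s(u, v) ∈ T.innerBoundary S ↔
      T.Adj u v ∧ ¬T.IsPendant u ∧ ¬T.IsPendant v ∧ ¬(u ∈ S ↔ v ∈ S) := by
  simp only [innerBoundary, mem_filter, mk_mem_innerEdges, Sym2.mem_iff, exists_eq_or_imp,
    exists_eq_left]
  tauto

lemma innerBoundary_sdiff {S X : Finset V} (hX : X ⊆ T.leafSet) :
    T.innerBoundary (S \ X) = T.innerBoundary S := by
  ext ⟨u, v⟩
  change s(u, v) ∈ _ ↔ s(u, v) ∈ _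
  rw [mk_mem_innerBoundary, mk_mem_innerBoundary]
  refine and_congr_right fun _ => and_congr_right fun hu => and_congr_right fun hv => ?_
  have hu' : u ∉ X := fun h => hu (by simpa using hX h)
  have hv' : v ∉ X := fun h => hv (by simpa using hX h)
  simp [hu', hv']

/-- The connected vertex sets with a non-pendant vertex and prescribed inner boundary. -/
noncomputable def boundaryFiber (T : SimpleGraph V) (P : Finset (Sym2 V)) : Finset (Finset V) :=
  (connSets T).filter fun S => ¬S ⊆ T.leafSet ∧ T.innerBoundary S = P

lemma mem_boundaryFiber {P : Finset (Sym2 V)} {S : Finset V} :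
    S ∈ T.boundaryFiber P ↔
      (T.induce (S : Set V)).Connected ∧ ¬S ⊆ T.leafSet ∧ T.innerBoundary S = P := by
  simp [boundaryFiber, mem_connSets]

/-- A pendant vertex is never interior to a path. -/
lemma PathClosed.sdiff_leaves {S X : Finset V} (hS : T.PathClosed (S : Set V))
    (hX : X ⊆ T.leafSet) : T.PathClosed ((S \ X : Finset V) : Set V) := by
  intro u v p hp hu hv w hw
  simp only [coe_sdiff, Set.mem_sdiff, mem_coe] at hu hv ⊢
  refine ⟨hS p hp hu.1 hv.1 w hw, fun hwX => ?_⟩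
  have hpend : T.IsPendant w := by simpa using hX hwX
  exact hpend.pathClosed_compl p hp (by rintro rfl; exact hu.2 hwX)
    (by rintro rfl; exact hv.2 hwX) w hw rfl

lemma PathClosed.mem_boundaryFiber (hT : T.Connected) {S X : Finset V}
    (hS : T.PathClosed (S : Set V)) (hX : X ⊆ T.leafSet) {z : V} (hz : ¬T.IsPendant z)
    (hzS : z ∈ S) : S \ X ∈ T.boundaryFiber (T.innerBoundary S) := by
  have hzX : z ∉ X := fun h => hz (by simpa using hX h)
  refine SimpleGraph.mem_boundaryFiber.2 ⟨(hS.sdiff_leaves hX).connected hT ⟨z, ?_⟩, ?_,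
    innerBoundary_sdiff hX⟩
  · simp [hzS, hzX]
  · exact fun h => hz (by simpa using h (mem_sdiff.2 ⟨hzS, hzX⟩))

lemma IsCut.innerBoundary_eq {e : Sym2 V} {C : Finset V} (h : T.IsCut e C)
    (he : e ∈ T.innerEdges) : T.innerBoundary C = {e} := by
  ext ⟨x, y⟩
  change s(x, y) ∈ _ ↔ s(x, y) ∈ _
  rw [mk_mem_innerBoundary, mem_singleton]
  constructor
  · rintro ⟨hxy, -, -, h'⟩
    exact (h hxy).1 (by simpa using h')
  · rintro rfl
    obtain ⟨h1, h2, h3⟩ := mk_mem_innerEdges.1 he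
    exact ⟨h1, h2, h3, by simpa using (h h1).2 rfl⟩

/-- Removing subsets of leaves from a path-closed set gives sets in the same fiber. -/
lemma PathClosed.image_subset_boundaryFiber (hT : T.Connected) {S : Finset V}
    (hS : T.PathClosed (S : Set V)) {z : V} (hz : ¬T.IsPendant z) (hzS : z ∈ S) :
    (T.leafSet ∩ S).powerset.image (S \ ·) ⊆ T.boundaryFiber (T.innerBoundary S) := by
  intro R hR
  obtain ⟨X, hX, rfl⟩ := mem_image.1 hR
  exact hS.mem_boundaryFiber hT ((mem_powerset.1 hX).trans inter_subset_left) hz hzS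

omit [Fintype V] in
lemma card_image_sdiff_powerset (S L : Finset V) :
    ((L ∩ S).powerset.image (S \ ·)).card = 2 ^ (L ∩ S).card := by
  rw [card_image_of_injOn, card_powerset]
  intro X hX Y hY hXY
  have h1 : X ⊆ S := (mem_powerset.1 hX).trans inter_subset_right
  have h2 : Y ⊆ S := (mem_powerset.1 hY).trans inter_subset_right
  rw [← Finset.sdiff_sdiff_eq_self h1, ← Finset.sdiff_sdiff_eq_self h2]
  exact congrArg (S \ ·) hXY

lemma two_pow_le_card_boundaryFiber_empty (hT : T.Connected) {z : V} (hz : ¬T.IsPendant z) :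
    2 ^ T.leafSet.card ≤ (T.boundaryFiber ∅).card := by
  have h : T.PathClosed ((univ : Finset V) : Set V) := fun _ _ _ _ _ _ _ _ => by simp
  have hb : T.innerBoundary univ = ∅ := by
    ext ⟨x, y⟩
    change s(x, y) ∈ _ ↔ s(x, y) ∈ _
    simp [mk_mem_innerBoundary]
  have := card_le_card (h.image_subset_boundaryFiber hT hz (mem_univ z))
  rwa [card_image_sdiff_powerset, inter_univ, hb] at this

/-- Each side of the cut has boundary `{e}` and may lose any of its leaves. The two families are
disjoint because the non-pendant end of `e` on each side is always kept. -/
lemma IsCut.two_pow_add_le_card_boundaryFiber (hT : T.Connected) {e : Sym2 V}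
    (he : e ∈ T.innerEdges) {C : Finset V} (hC : T.IsCut e C) :
    2 ^ (T.leafSet ∩ C).card + 2 ^ (T.leafSet.card - (T.leafSet ∩ C).card) ≤
      (T.boundaryFiber {e}).card := by
  induction e with | h u v
  obtain ⟨huv, hu, hv⟩ := mk_mem_innerEdges.1 he
  have hCc : T.IsCut s(u, v) ((Cᶜ : Finset V) : Set V) := by
    rw [coe_compl]
    exact hC.compl
  have huvC : ¬(u ∈ C ↔ v ∈ C) := by simpa using (hC huv).2 rfl
  obtain ⟨z, z', hz, hz', hzC, hzC', hzz⟩ : ∃ z z', ¬T.IsPendant z ∧ ¬T.IsPendant z' ∧ z ∈ C ∧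
      z' ∉ C ∧ (∀ x, x = z ∨ x = z' ↔ x = u ∨ x = v) := by
    by_cases h : u ∈ C
    · exact ⟨u, v, hu, hv, h, by tauto, by tauto⟩
    · exact ⟨v, u, hv, hu, by tauto, h, by tauto⟩
  have h1 := hC.pathClosed.image_subset_boundaryFiber hT hz hzC
  have h2 := hCc.pathClosed.image_subset_boundaryFiber hT hz' (mem_compl.2 hzC')
  rw [hC.innerBoundary_eq he] at h1
  rw [hCc.innerBoundary_eq he] at h2
  have hd : Disjoint ((T.leafSet ∩ C).powerset.image (C \ ·))
      ((T.leafSet ∩ Cᶜ).powerset.image (Cᶜ \ ·)) := by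
    rw [Finset.disjoint_left]
    intro R hR hR'
    obtain ⟨X, hX, rfl⟩ := mem_image.1 hR
    obtain ⟨Y, hY, hXY⟩ := mem_image.1 hR'
    have hzX : z ∉ X := fun h => hz (by simpa using (mem_inter.1 (mem_powerset.1 hX h)).1)
    have : z ∈ Cᶜ \ Y := by
      rw [hXY]
      exact mem_sdiff.2 ⟨hzC, hzX⟩
    simp [hzC] at this
  have h3 := card_le_card (union_subset h1 h2)
  rw [card_union_of_disjoint hd, card_image_sdiff_powerset, card_image_sdiff_powerset] at h3
  have h4 : (T.leafSet ∩ C).card + (T.leafSet ∩ Cᶜ).card = T.leafSet.card := by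
    rw [← sdiff_eq_inter_compl]
    exact card_inter_add_card_sdiff _ _
  rwa [← h4, Nat.add_sub_cancel_left]

/-- Every edge has a cut containing both ends of a given other edge. -/
lemma IsAcyclic.exists_isCut_containing (hT : T.IsAcyclic) {u v x y : V} (huv : T.Adj u v)
    (hxy : T.Adj x y) (hne : s(x, y) ≠ s(u, v)) :
    ∃ C : Finset V, T.IsCut s(u, v) C ∧ x ∈ C ∧ y ∈ C := by
  obtain ⟨C, -, -, hC⟩ := hT.exists_isCut huv
  have h : x ∈ C ↔ y ∈ C := by
    by_contra h
    exact hne ((hC hxy).1 h)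
  by_cases hx : x ∈ C
  · exact ⟨C.toFinset, by simpa using hC, by simpa using hx, by simpa using h.1 hx⟩
  · exact ⟨Cᶜ.toFinset, by simpa using hC.compl, by simpa using hx,
      by simpa using fun h' => hx (h.2 h')⟩

/-- The witness is the part of the tree between `e` and `f`: the side of `e` containing `f`
intersected with the side of `f` containing `e`. -/
lemma IsTree.boundaryFiber_pair_nonempty (hT : T.IsTree) {e f : Sym2 V} (he : e ∈ T.innerEdges)
    (hf : f ∈ T.innerEdges) (hne : e ≠ f) : (T.boundaryFiber {e, f}).Nonempty := by
  induction e with | h u v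
  induction f with | h x y
  obtain ⟨huv, hu, hv⟩ := mk_mem_innerEdges.1 he
  obtain ⟨hxy, hx, hy⟩ := mk_mem_innerEdges.1 hf
  obtain ⟨C, hC, hxC, hyC⟩ := hT.isAcyclic.exists_isCut_containing huv hxy hne.symm
  obtain ⟨D, hD, huD, hvD⟩ := hT.isAcyclic.exists_isCut_containing hxy huv hne
  have hpc : T.PathClosed ((C ∩ D : Finset V) : Set V) := by
    rw [coe_inter]
    exact hC.pathClosed.inter hD.pathClosed
  have huvC : ¬(u ∈ C ↔ v ∈ C) := by simpa using (hC huv).2 rfl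
  have hxyD : ¬(x ∈ D ↔ y ∈ D) := by simpa using (hD hxy).2 rfl
  obtain ⟨z, hz, hzC⟩ : ∃ z, ¬T.IsPendant z ∧ z ∈ C ∩ D := by
    by_cases h : u ∈ C
    · exact ⟨u, hu, mem_inter.2 ⟨h, huD⟩⟩
    · exact ⟨v, hv, mem_inter.2 ⟨by tauto, hvD⟩⟩
  have h := hpc.mem_boundaryFiber hT.connected (empty_subset _) hz hzC
  have hb : T.innerBoundary (C ∩ D) = {s(u, v), s(x, y)} := by
    ext ⟨p, q⟩
    change s(p, q) ∈ _ ↔ s(p, q) ∈ _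
    rw [mk_mem_innerBoundary, mem_insert, mem_singleton, mem_inter, mem_inter]
    constructor
    · rintro ⟨hpq, -, -, h'⟩
      by_contra! hcon
      have h1 : p ∈ C ↔ q ∈ C := by
        by_contra h1
        exact hcon.1 ((hC hpq).1 (by simpa using h1))
      have h2 : p ∈ D ↔ q ∈ D := by
        by_contra h2
        exact hcon.2 ((hD hpq).1 (by simpa using h2))
      exact h' (by rw [h1, h2])
    · rintro (h' | h') <;> rcases Sym2.eq_iff.1 h' with ⟨rfl, rfl⟩ | ⟨rfl, rfl⟩
      · exact ⟨huv, hu, hv, by tauto⟩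
      · exact ⟨huv.symm, hv, hu, by tauto⟩
      · exact ⟨hxy, hx, hy, by tauto⟩
      · exact ⟨hxy.symm, hy, hx, by tauto⟩
  exact ⟨_, hb ▸ h⟩

/-- The edges that are not inner correspond to the leaves, since no edge joins two leaves. -/
lemma IsTree.card_innerEdges (hT : T.IsTree) (hV : 3 ≤ Fintype.card V) :
    T.innerEdges.card + T.leafSet.card + 1 = Fintype.card V := by
  rw [← hT.card_edgeFinset, ← card_filter_add_card_filter_not
    (s := T.edgeFinset) (fun e => ∀ v ∈ e, ¬T.IsPendant v)]
  congr 2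
  · congr 1
    ext e
    simp [innerEdges]
  · refine card_bij (fun v hv => s(v, (mem_leafSet.1 hv).choose)) ?_ ?_ ?_
    · intro v hv
      have h := (mem_leafSet.1 hv).choose_spec.1
      simp only [mem_filter, mem_edgeFinset, mem_edgeSet]
      exact ⟨h, fun h' => h' v (by simp) (mem_leafSet.1 hv)⟩
    · intro v hv w hw hvw
      rcases Sym2.eq_iff.1 hvw with ⟨h, -⟩ | ⟨h1, h2⟩
      · exact h
      · exfalso
        have h := (mem_leafSet.1 hv).choose_spec.1
        simp only [h2] at h
        exact not_adj_of_isPendant hT.connected hV (mem_leafSet.1 hv) (mem_leafSet.1 hw) h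
    · intro e he
      induction e with | h x y
      simp only [mem_filter, mem_edgeFinset, mem_edgeSet, Sym2.mem_iff] at he
      obtain ⟨hxy, h⟩ := he
      by_cases hx : T.IsPendant x
      · exact ⟨x, mem_leafSet.2 hx, by rw [← hx.choose_spec.2 y hxy]⟩
      · have hy : T.IsPendant y := by
          by_contra hy
          exact h (by rintro v (rfl | rfl) <;> assumption)
        exact ⟨y, mem_leafSet.2 hy, by rw [← hy.choose_spec.2 x hxy.symm, Sym2.eq_swap]⟩

lemma leafSet_card_add_sum_le (T : SimpleGraph V) :
    T.leafSet.card + ∑ P ∈ T.innerEdges.powerset, (T.boundaryFiber P).card ≤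
      (connSets T).card := by
  rw [← card_filter_add_card_filter_not (s := connSets T) (fun S => S ⊆ T.leafSet)]
  refine Nat.add_le_add ?_ (le_of_eq ?_)
  · rw [← card_image_of_injective T.leafSet (singleton_injective (α := V))]
    refine card_le_card fun S hS => ?_
    obtain ⟨v, hv, rfl⟩ := mem_image.1 hS
    refine mem_filter.2 ⟨mem_connSets.2 ?_, by simpa using hv⟩
    rw [coe_singleton]
    exact ⟨Preconnected.of_subsingleton⟩
  · rw [card_eq_sum_card_fiberwise (f := T.innerBoundary) (t := T.innerEdges.powerset)]
    · refine sum_congr rfl fun P _ => ?_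
      congr 1
      ext S
      simp [boundaryFiber, and_assoc]
    · intro S _
      exact mem_powerset.2 (filter_subset _ _)

end Tree

/-! ### Numerical facts -/

lemma balanced_two_pow_le (k x : ℕ) (hx : x ≤ k) :
    2 ^ (k / 2) + 2 ^ ((k + 1) / 2) ≤ 2 ^ x + 2 ^ (k - x) ∧
      (2 ^ x + 2 ^ (k - x) ≤ 2 ^ (k / 2) + 2 ^ ((k + 1) / 2) → x = k / 2 ∨ x = (k + 1) / 2) := by
  have key : ∀ y, y < k / 2 → 2 ^ (k / 2) + 2 ^ ((k + 1) / 2) < 2 ^ y + 2 ^ (k - y) := by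
    intro y hy
    have h1 : 2 ^ ((k + 1) / 2 + 1) ≤ 2 ^ (k - y) :=
      Nat.pow_le_pow_right (by norm_num) (by omega)
    have h2 : 2 ^ (k / 2) ≤ 2 ^ ((k + 1) / 2) := Nat.pow_le_pow_right (by norm_num) (by omega)
    have h3 : 0 < 2 ^ y := by positivity
    rw [pow_succ] at h1
    omega
  rcases lt_or_ge x (k / 2) with h | h
  · exact ⟨(key x h).le, fun h' => absurd (key x h) (not_lt.2 h')⟩
  rcases lt_or_ge (k - x) (k / 2) with h' | h'
  · have := key _ h'
    rw [Nat.sub_sub_self hx, add_comm (2 ^ (k - x))] at this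
    exact ⟨this.le, fun h' => absurd this (not_lt.2 h')⟩
  · rcases (by omega : x = k / 2 ∨ x = (k + 1) / 2) with rfl | rfl
    · rw [show k - k / 2 = (k + 1) / 2 by omega]
      exact ⟨le_rfl, fun _ => Or.inl rfl⟩
    · rw [show k - (k + 1) / 2 = k / 2 by omega, add_comm]
      exact ⟨le_rfl, fun _ => Or.inr rfl⟩

/-- The core index of the balanced double broom with `k` pendant vertices and a path with `m`
edges. -/
def broomCount (k m : ℕ) : ℕ :=
  k + (2 ^ k + m * (2 ^ (k / 2) + 2 ^ ((k + 1) / 2)) + m.choose 2)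

/-- With `a = 2^(k/2)` and `b = 2^((k+1)/2)`, the difference of the two sides is `(a - 1)(b - 1) +
m(a - 1)`. -/
lemma broomCount_le_succ (k m : ℕ) : broomCount k (m + 1) ≤ broomCount (k + 1) m := by
  have h1 : (k + 1 + 1) / 2 = k / 2 + 1 := by omega
  have h2 : 2 ^ k = 2 ^ (k / 2) * 2 ^ ((k + 1) / 2) := by
    rw [← pow_add]
    congr 1
    omega
  have ha : 1 ≤ 2 ^ (k / 2) := Nat.one_le_two_pow
  have hb : 1 ≤ 2 ^ ((k + 1) / 2) := Nat.one_le_two_pow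
  have h3 : (m + 1).choose 2 = m + m.choose 2 := by
    rw [Nat.choose_succ_succ' m 1, Nat.choose_one_right]
  unfold broomCount
  rw [h1, h3, pow_succ 2 k, pow_succ 2 (k / 2), h2]
  generalize 2 ^ (k / 2) = a at *
  generalize 2 ^ ((k + 1) / 2) = b at *
  obtain ⟨a, rfl⟩ := Nat.exists_eq_add_of_le ha
  obtain ⟨b, rfl⟩ := Nat.exists_eq_add_of_le hb
  nlinarith [Nat.zero_le (a * b), Nat.zero_le (m * a), Nat.zero_le (m * b), Nat.zero_le m]

lemma broomCount_add_le (k m j : ℕ) : broomCount k (m + j) ≤ broomCount (k + j) m := by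
  induction j generalizing k with
  | zero => rfl
  | succ j ih =>
    calc broomCount k (m + (j + 1)) ≤ broomCount (k + 1) (m + j) := broomCount_le_succ k (m + j)
      _ ≤ broomCount (k + 1 + j) m := ih (k + 1)
      _ = broomCount (k + (j + 1)) m := by congr 1; omega

/-- The number of connected sets with a given inner boundary of size `j` in a balanced double
broom. -/
def fiberCount (k : ℕ) : ℕ → ℕ
  | 0 => 2 ^ k
  | 1 => 2 ^ (k / 2) + 2 ^ ((k + 1) / 2)
  | 2 => 1
  | _ => 0

lemma sum_powerset_fiberCount {α : Type*} (k : ℕ) (E : Finset α) :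
    k + ∑ P ∈ E.powerset, fiberCount k P.card = broomCount k E.card := by
  rw [sum_powerset_apply_card, broomCount]
  congr 1
  have h : ∀ m : ℕ, ∑ j ∈ range (m + 1), m.choose j • fiberCount k j =
      ∑ j ∈ range 3, m.choose j • fiberCount k j := by
    intro m
    rcases le_or_gt 3 (m + 1) with hm | hm
    · refine (sum_subset (range_subset_range.2 hm) fun j _ hj => ?_).symm
      have : 3 ≤ j := by simpa using hj
      obtain ⟨j, rfl⟩ := Nat.exists_eq_add_of_le' this
      simp [fiberCount]
    · refine sum_subset (range_subset_range.2 hm.le) fun j _ hj => ?_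
      rw [Nat.choose_eq_zero_of_lt (by simpa using hj), zero_smul]
  rw [h]
  simp [sum_range_succ, fiberCount]

/-! ### The lower bound for trees, fiber by fiber -/

section Tree

open Classical

variable {V : Type*} {T : SimpleGraph V} [Fintype V]

lemma exists_not_isPendant (hT : T.Connected) (hV : 3 ≤ Fintype.card V) :
    ∃ z, ¬T.IsPendant z := by
  by_contra! h
  obtain ⟨v⟩ := hT.nonempty
  obtain ⟨w, hw, -⟩ := h v
  exact not_adj_of_isPendant hT hV (h v) (h w) hw

lemma IsTree.fiberCount_le (hT : T.IsTree) (hV : 3 ≤ Fintype.card V) {P : Finset (Sym2 V)}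
    (hP : P ⊆ T.innerEdges) :
    fiberCount T.leafSet.card P.card ≤ (T.boundaryFiber P).card := by
  rcases h : P.card with _ | _ | _ | j
  · obtain ⟨z, hz⟩ := exists_not_isPendant hT.connected hV
    rw [card_eq_zero.1 h]
    exact two_pow_le_card_boundaryFiber_empty hT.connected hz
  · obtain ⟨e, rfl⟩ := card_eq_one.1 h
    have he : e ∈ T.innerEdges := hP (mem_singleton_self e)
    induction e with | h u v
    obtain ⟨C, -, -, hC⟩ := hT.isAcyclic.exists_isCut (mk_mem_innerEdges.1 he).1
    have hC' : T.IsCut s(u, v) (C.toFinset : Set V) := by simpa using hC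
    exact (balanced_two_pow_le _ _ (card_le_card inter_subset_left)).1.trans
      (hC'.two_pow_add_le_card_boundaryFiber hT.connected he)
  · obtain ⟨e, f, hne, rfl⟩ := card_eq_two.1 h
    exact card_pos.2 (hT.boundaryFiber_pair_nonempty (hP (by simp)) (hP (by simp)) hne)
  · exact Nat.zero_le _

lemma IsTree.broomCount_le (hT : T.IsTree) (hV : 3 ≤ Fintype.card V) :
    broomCount T.leafSet.card T.innerEdges.card ≤ (connSets T).card := by
  rw [← sum_powerset_fiberCount]
  refine le_trans ?_ T.leafSet_card_add_sum_le
  gcongr with P hP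
  exact hT.fiberCount_le hV (mem_powerset.1 hP)

/-- Termwise inequalities whose sums agree are equalities. -/
lemma IsTree.card_boundaryFiber_eq (hT : T.IsTree) (hV : 3 ≤ Fintype.card V)
    (h : (connSets T).card ≤ broomCount T.leafSet.card T.innerEdges.card) {P : Finset (Sym2 V)}
    (hP : P ⊆ T.innerEdges) : (T.boundaryFiber P).card = fiberCount T.leafSet.card P.card := by
  have hle : ∀ P ∈ T.innerEdges.powerset,
      fiberCount T.leafSet.card P.card ≤ (T.boundaryFiber P).card :=
    fun P hP => hT.fiberCount_le hV (mem_powerset.1 hP)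
  have h1 := T.leafSet_card_add_sum_le
  have h2 := sum_powerset_fiberCount T.leafSet.card T.innerEdges
  have h3 := sum_le_sum hle
  exact ((sum_eq_sum_iff_of_le hle).1 (by omega) P (mem_powerset.2 hP)).symm

end Tree

end SimpleGraph

namespace SimpleGraph

open Finset

/-! ### Connected subgraphs of the double broom -/

section DoubleBroom

variable {a b m : ℕ}

/-- The left leaves together with the path vertices of index at most `t`. -/
def broomLeft (a b m t : ℕ) : Set (Fin (m + 1) ⊕ (Fin a ⊕ Fin b)) :=
  {x | Sum.elim (fun s => s.val ≤ t) (Sum.elim (fun _ => True) (fun _ => False)) x}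

@[simp] lemma inl_mem_broomLeft {t : ℕ} {s : Fin (m + 1)} :
    Sum.inl s ∈ broomLeft a b m t ↔ s.val ≤ t := Iff.rfl

@[simp] lemma inr_inl_mem_broomLeft {t : ℕ} {s : Fin a} :
    Sum.inr (Sum.inl s) ∈ broomLeft a b m t := trivial

@[simp] lemma inr_inr_mem_broomLeft {t : ℕ} {s : Fin b} :
    Sum.inr (Sum.inr s) ∉ broomLeft a b m t := id

/-- The foot of a leaf of the double broom. -/
def broomFoot (a b m : ℕ) : Fin a ⊕ Fin b → Fin (m + 1) :=
  Sum.elim (fun _ => 0) (fun _ => Fin.last m)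

lemma doubleBroom_adj_inr_iff {l : Fin a ⊕ Fin b} {y : Fin (m + 1) ⊕ (Fin a ⊕ Fin b)} :
    (doubleBroom a b (m + 1)).Adj (Sum.inr l) y ↔ y = Sum.inl (broomFoot a b m l) := by
  rcases l with l | l <;> rcases y with y | y
  · change y.val = 0 ↔ Sum.inl y = Sum.inl (0 : Fin (m + 1))
    rw [Sum.inl.injEq, Fin.ext_iff, Fin.val_zero]
  · exact iff_of_false id (by simp)
  · change y.val + 1 = m + 1 ↔ Sum.inl y = Sum.inl (Fin.last m)
    rw [Sum.inl.injEq, Fin.ext_iff, Fin.val_last, Nat.add_right_cancel_iff]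
  · exact iff_of_false id (by simp)

lemma doubleBroom_adj_inl_inl {s t : Fin (m + 1)} :
    (doubleBroom a b (m + 1)).Adj (Sum.inl s) (Sum.inl t) ↔
      s.val + 1 = t.val ∨ t.val + 1 = s.val := Iff.rfl

variable {H : (doubleBroom a b (m + 1)).Subgraph}

/-- The path edge from `s` to `t` is the only edge of the broom leaving `broomLeft a b m s`. -/
lemma doubleBroom_adj_of_crossing (hH : H.Connected) {s t : Fin (m + 1)} (hst : s.val + 1 = t.val)
    {x y : Fin (m + 1) ⊕ (Fin a ⊕ Fin b)} (hx : x ∈ H.verts) (hy : y ∈ H.verts)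
    (hxs : x ∈ broomLeft a b m s) (hys : y ∉ broomLeft a b m s) :
    H.Adj (Sum.inl s) (Sum.inl t) := by
  obtain ⟨u, v, huv, hu, hv⟩ := hH.exists_adj_crossing _ hx hy hxs hys
  have hadj := H.adj_sub huv
  have ht := t.2
  rcases u with u | u
  · rcases v with v | v
    · rw [doubleBroom_adj_inl_inl] at hadj
      simp only [inl_mem_broomLeft] at hu hv
      obtain rfl : u = s := Fin.ext (by omega)
      obtain rfl : v = t := Fin.ext (by omega)
      exact huv
    · obtain h := doubleBroom_adj_inr_iff.1 hadj.symm
      simp only [Sum.inl.injEq] at h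
      rcases v with v | v
      · simp at hv
      · simp [h, broomFoot] at hu
        omega
  · obtain h := doubleBroom_adj_inr_iff.1 hadj
    rcases u with u | u
    · simp [h, broomFoot] at hv
    · simp at hu

lemma doubleBroom_adj_foot (hH : H.Connected) {l : Fin a ⊕ Fin b} (hl : Sum.inr l ∈ H.verts)
    {y : Fin (m + 1) ⊕ (Fin a ⊕ Fin b)} (hy : y ∈ H.verts) (hne : y ≠ Sum.inr l) :
    H.Adj (Sum.inr l) (Sum.inl (broomFoot a b m l)) := by
  obtain ⟨u, v, huv, hu, hv⟩ := hH.exists_adj_crossing {Sum.inr l} hl hy rfl (by simpa using hne)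
  obtain rfl : u = Sum.inr l := by simpa using hu
  rwa [doubleBroom_adj_inr_iff.1 (H.adj_sub huv)] at huv

lemma doubleBroom_subgraph_eq {K : (doubleBroom a b (m + 1)).Subgraph} (hH : H.Connected)
    (hK : K.Connected) (h : H.verts = K.verts) : H = K := by
  have key : ∀ {H K : (doubleBroom a b (m + 1)).Subgraph}, H.Connected → K.Connected →
      H.verts = K.verts → ∀ x y, H.Adj x y → K.Adj x y := by
    intro H K hH hK h x y hxy
    have hx : x ∈ K.verts := h ▸ H.edge_vert hxy
    have hy : y ∈ K.verts := h ▸ H.edge_vert hxy.symm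
    have hadj := H.adj_sub hxy
    rcases x with x | x
    · rcases y with y | y
      · rcases doubleBroom_adj_inl_inl.1 hadj with h' | h'
        · exact doubleBroom_adj_of_crossing hK h' hx hy (by simp) (by simp; omega)
        · exact (doubleBroom_adj_of_crossing hK h' hy hx (by simp) (by simp; omega)).symm
      · have h1 := doubleBroom_adj_inr_iff.1 hadj.symm
        have h2 := doubleBroom_adj_foot hK hy hx (by simp)
        rw [← h1] at h2
        exact h2.symm
    · have h1 := doubleBroom_adj_inr_iff.1 hadj
      have h2 := doubleBroom_adj_foot hK hx hy (hadj.ne.symm)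
      rwa [← h1] at h2
  ext x y
  · rw [h]
  · exact ⟨key hH hK h x y, key hK hH h.symm x y⟩

/-- The vertex set consisting of the path vertices with index in `I`, the left leaves in `A` and
the right leaves in `B`. -/
def broomSet {a b m : ℕ} (I : ℕ → Prop) (A : Finset (Fin a)) (B : Finset (Fin b)) :
    Set (Fin (m + 1) ⊕ (Fin a ⊕ Fin b)) :=
  {x | Sum.elim (fun t => I t.val) (Sum.elim (· ∈ A) (· ∈ B)) x}

/-- Codes for the connected vertex sets of the double broom. -/
abbrev BroomCode (a b m : ℕ) : Type :=
  (Fin a ⊕ Fin b) ⊕ (Finset (Fin a) × Finset (Fin b)) ⊕ (Fin m × Finset (Fin a)) ⊕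
    (Fin m × Finset (Fin b)) ⊕ (powersetCard 2 (univ : Finset (Fin m)))

/-- The connected vertex set with a given code. -/
def BroomCode.toSet : BroomCode a b m → Set (Fin (m + 1) ⊕ (Fin a ⊕ Fin b))
  | .inl l => {Sum.inr l}
  | .inr (.inl (A, B)) => broomSet (fun _ => True) A B
  | .inr (.inr (.inl (j, A))) => broomSet (fun t => t ≤ j) A ∅
  | .inr (.inr (.inr (.inl (i, B)))) => broomSet (fun t => i.val < t) ∅ B
  | .inr (.inr (.inr (.inr s))) =>
      broomSet (fun t => (∃ i ∈ s.1, i.val < t) ∧ ∃ j ∈ s.1, t ≤ j.val) ∅ ∅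

lemma card_broomCode : Nat.card (BroomCode a b m) =
    (a + b) + (2 ^ (a + b) + m * (2 ^ a + 2 ^ b) + m.choose 2) := by
  simp [BroomCode, Fintype.card_finset, pow_add]
  ring

/-- The path vertices of `H`, if any, fill an interval `[i, j]`, and leaves at an end of the path
can occur only if the interval reaches that end. Whether `i = 0` and whether `j = m` selects the
code; without path vertices `H` is a single leaf. -/
lemma exists_broomCode (hH : H.Connected) : ∃ c : BroomCode a b m, c.toSet = H.verts := by
  classical
  obtain ⟨z, hz⟩ := hH.nonempty
  by_cases hpath : ∃ t : Fin (m + 1), Sum.inl t ∈ H.verts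
  · let I : Finset (Fin (m + 1)) := univ.filter fun t => Sum.inl t ∈ H.verts
    have hI : ∀ t, t ∈ I ↔ Sum.inl t ∈ H.verts := fun t => by simp [I]
    obtain ⟨t₀, ht₀⟩ := hpath
    have hne : I.Nonempty := ⟨t₀, (hI t₀).2 ht₀⟩
    obtain ⟨i, hi, himin⟩ : ∃ i ∈ I, ∀ t ∈ I, i.val ≤ t.val :=
      ⟨I.min' hne, I.min'_mem hne, fun t ht => I.min'_le t ht⟩
    obtain ⟨j, hj, hjmax⟩ : ∃ j ∈ I, ∀ t ∈ I, t.val ≤ j.val :=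
      ⟨I.max' hne, I.max'_mem hne, fun t ht => I.le_max' t ht⟩
    rw [hI] at hi hj
    have hint : ∀ t, Sum.inl t ∈ H.verts ↔ i.val ≤ t.val ∧ t.val ≤ j.val := by
      intro t
      rw [← hI]
      refine ⟨fun h => ⟨himin t h, hjmax t h⟩, fun ⟨h1, h2⟩ => (hI t).2 ?_⟩
      rcases h2.eq_or_lt with h2 | h2
      · rwa [Fin.ext h2]
      · have hj' := j.2
        exact H.edge_vert (doubleBroom_adj_of_crossing hH (s := t) (t := ⟨t.val + 1, by omega⟩) rfl
          hi hj h1 (by simpa using h2))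
    have hij : i.val ≤ j.val := ((hint i).1 hi).2
    have hA : ∀ s, Sum.inr (Sum.inl s) ∈ H.verts → i.val = 0 := by
      intro s hs
      have := (hint _).1 (H.edge_vert (doubleBroom_adj_foot hH hs hi (by simp)).symm)
      simpa [broomFoot] using this.1
    have hB : ∀ s, Sum.inr (Sum.inr s) ∈ H.verts → j.val = m := by
      intro s hs
      have := (hint _).1 (H.edge_vert (doubleBroom_adj_foot hH hs hi (by simp)).symm)
      have hj' := j.2
      simp [broomFoot] at this
      omega
    let A : Finset (Fin a) := univ.filter fun s => Sum.inr (Sum.inl s) ∈ H.verts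
    let B : Finset (Fin b) := univ.filter fun s => Sum.inr (Sum.inr s) ∈ H.verts
    have hset : ∀ (P : ℕ → Prop) (A' : Finset (Fin a)) (B' : Finset (Fin b)),
        (∀ t : Fin (m + 1), P t ↔ i.val ≤ t.val ∧ t.val ≤ j.val) →
        (∀ s, s ∈ A' ↔ Sum.inr (Sum.inl s) ∈ H.verts) →
        (∀ s, s ∈ B' ↔ Sum.inr (Sum.inr s) ∈ H.verts) →
        (broomSet P A' B' : Set (Fin (m + 1) ⊕ (Fin a ⊕ Fin b))) = H.verts := by
      intro P A' B' h1 h2 h3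
      ext (t | s | s)
      · exact (h1 t).trans (hint t).symm
      · exact h2 s
      · exact h3 s
    have hAmem : ∀ s, s ∈ A ↔ Sum.inr (Sum.inl s) ∈ H.verts := fun s => by simp [A]
    have hBmem : ∀ s, s ∈ B ↔ Sum.inr (Sum.inr s) ∈ H.verts := fun s => by simp [B]
    have hAempty : i.val ≠ 0 → ∀ s, s ∈ (∅ : Finset (Fin a)) ↔ Sum.inr (Sum.inl s) ∈ H.verts :=
      fun h s => iff_of_false (by simp) fun hs => h (hA s hs)
    have hBempty : j.val ≠ m → ∀ s, s ∈ (∅ : Finset (Fin b)) ↔ Sum.inr (Sum.inr s) ∈ H.verts :=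
      fun h s => iff_of_false (by simp) fun hs => h (hB s hs)
    have hjm : j.val ≤ m := Nat.lt_succ_iff.1 j.2
    by_cases hi0 : i.val = 0 <;> by_cases hjl : j.val = m
    · exact ⟨.inr (.inl (A, B)), hset (fun _ => True) A B (fun t => by have := t.2; simp; omega) hAmem hBmem⟩
    · exact ⟨.inr (.inr (.inl (⟨j.val, by omega⟩, A))),
        hset (· ≤ j.val) A ∅ (fun t => by simp; omega) hAmem (hBempty hjl)⟩
    · exact ⟨.inr (.inr (.inr (.inl (⟨i.val - 1, by omega⟩, B)))),
        hset (i.val - 1 < ·) ∅ B (fun t => by have := t.2; simp; omega) (hAempty hi0) hBmem⟩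
    -- An interval missing both ends is coded by the two path edges bounding it, each indexed by its
    -- lower end.
    · let p : Fin m := ⟨i.val - 1, by omega⟩
      let q : Fin m := ⟨j.val, by omega⟩
      have hpq : p ≠ q := by
        simp only [p, q, ne_eq, Fin.mk.injEq]
        omega
      refine ⟨.inr (.inr (.inr (.inr ⟨{p, q}, by simp [card_pair hpq]⟩))),
        hset (fun t => (∃ i ∈ ({p, q} : Finset (Fin m)), i.val < t) ∧
          ∃ j ∈ ({p, q} : Finset (Fin m)), t ≤ j.val) ∅ ∅ (fun t => ?_) (hAempty hi0) (hBempty hjl)⟩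
      simp only [mem_insert, mem_singleton, exists_eq_or_imp, exists_eq_left, p, q]
      omega
  · have hz' : ∃ l, z = Sum.inr l := by
      rcases z with z | l
      · exact absurd ⟨z, hz⟩ hpath
      · exact ⟨l, rfl⟩
    obtain ⟨l, rfl⟩ := hz'
    refine ⟨.inl l, ?_⟩
    ext y
    simp only [BroomCode.toSet, Set.mem_singleton_iff]
    refine ⟨fun h => h ▸ hz, fun hy => ?_⟩
    by_contra hne
    exact hpath ⟨_, H.edge_vert (doubleBroom_adj_foot hH hz hy hne).symm⟩

lemma coreIndex_doubleBroom_le : coreIndex (doubleBroom a b (m + 1)) ≤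
    (a + b) + (2 ^ (a + b) + m * (2 ^ a + 2 ^ b) + m.choose 2) := by
  rw [← card_broomCode, coreIndex]
  choose c hc using fun H : {H : (doubleBroom a b (m + 1)).Subgraph // H.Connected} =>
    exists_broomCode H.2
  refine Nat.card_le_card_of_injective c fun H K h => Subtype.ext ?_
  exact doubleBroom_subgraph_eq H.2 K.2 (by rw [← hc H, ← hc K, h])

end DoubleBroom

end SimpleGraph

namespace SimpleGraph

open Finset

/-! ### The equality case -/

section Equality

open Classical

variable {V : Type*} {T : SimpleGraph V} [Fintype V]

/-- The inner boundary of `{v}` consists of the inner edges at `v`, at least two. Its fiber contains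
`{v}`, so tightness makes the boundary a pair and the fiber a singleton. A third non-pendant
neighbour would enlarge the boundary; a pendant one would put `{v, w₃}` in the fiber. -/
lemma eq_or_eq_of_tight
    (h : ∀ P ⊆ T.innerEdges, (T.boundaryFiber P).card = fiberCount T.leafSet.card P.card)
    {v w₁ w₂ w₃ : V} (hv : ¬T.IsPendant v) (hw₁ : ¬T.IsPendant w₁) (hw₂ : ¬T.IsPendant w₂)
    (h₁ : T.Adj v w₁) (h₂ : T.Adj v w₂) (hne : w₁ ≠ w₂) (h₃ : T.Adj v w₃) :
    w₃ = w₁ ∨ w₃ = w₂ := by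
  by_contra! hcon
  have hinj : Function.Injective fun w => s(v, w) := fun _ _ h => Sym2.congr_right.1 h
  have hmem : ∀ w, ¬T.IsPendant w → T.Adj v w → s(v, w) ∈ T.innerBoundary {v} := fun w hw hvw =>
    mk_mem_innerBoundary.2 ⟨hvw, hv, hw, by simpa using hvw.ne.symm⟩
  have hsingle : {v} ∈ T.boundaryFiber (T.innerBoundary {v}) := by
    refine mem_boundaryFiber.2 ⟨?_, by simpa using hv, rfl⟩
    rw [coe_singleton]
    exact ⟨Preconnected.of_subsingleton⟩
  have hP := h (T.innerBoundary {v}) (filter_subset _ _)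
  have hpos := card_pos.2 ⟨_, hsingle⟩
  have hlt : (T.innerBoundary {v}).card < 3 := by
    by_contra! hge
    obtain ⟨j, hj⟩ := Nat.exists_eq_add_of_le' hge
    rw [hP, hj] at hpos
    exact absurd hpos (lt_irrefl 0)
  have hge : 2 ≤ (T.innerBoundary {v}).card := by
    rw [← card_pair (hinj.ne hne)]
    refine card_le_card ?_
    simp only [insert_subset_iff, singleton_subset_iff]
    exact ⟨hmem _ hw₁ h₁, hmem _ hw₂ h₂⟩
  by_cases hw₃ : T.IsPendant w₃
  · have hpair : {v, w₃} ∈ T.boundaryFiber (T.innerBoundary {v}) := by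
      refine mem_boundaryFiber.2 ⟨?_, fun hs => hv (by simpa using hs (mem_insert_self _ _)), ?_⟩
      · rw [coe_pair]
        exact induce_pair_connected_of_adj h₃
      · rw [← innerBoundary_sdiff (S := {v, w₃}) (X := {w₃}) (by simpa using hw₃)]
        congr 1
        ext x
        simp only [mem_sdiff, mem_insert, mem_singleton]
        have := h₃.ne
        grind
    have hnep : ({v} : Finset V) ≠ {v, w₃} := fun he => by
      have : w₃ ∈ ({v} : Finset V) := he ▸ by simp
      exact h₃.ne (mem_singleton.1 this).symm
    have h2 : ({{v}, {v, w₃}} : Finset (Finset V)).card ≤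
        (T.boundaryFiber (T.innerBoundary {v})).card :=
      card_le_card (by simp only [insert_subset_iff, singleton_subset_iff]; exact ⟨hsingle, hpair⟩)
    rw [card_pair hnep, hP, show (T.innerBoundary {v}).card = 2 by omega] at h2
    exact absurd h2 (by simp [fiberCount])
  · have h3 : ({s(v, w₁), s(v, w₂), s(v, w₃)} : Finset (Sym2 V)).card = 3 :=
      card_eq_three.2 ⟨_, _, _, hinj.ne hne, hinj.ne hcon.1.symm, hinj.ne hcon.2.symm, rfl⟩
    have h4 : ({s(v, w₁), s(v, w₂), s(v, w₃)} : Finset (Sym2 V)) ⊆ T.innerBoundary {v} := by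
      simp only [insert_subset_iff, singleton_subset_iff]
      exact ⟨hmem _ hw₁ h₁, hmem _ hw₂ h₂, hmem _ hw₃ h₃⟩
    have := card_le_card h4
    omega

lemma IsCut.card_leaves_eq_of_tight (hT : T.Connected)
    (h : ∀ P ⊆ T.innerEdges, (T.boundaryFiber P).card = fiberCount T.leafSet.card P.card)
    {e : Sym2 V} (he : e ∈ T.innerEdges) {C : Finset V} (hC : T.IsCut e C) :
    (T.leafSet ∩ C).card = T.leafSet.card / 2 ∨
      (T.leafSet ∩ C).card = (T.leafSet.card + 1) / 2 := by
  refine (balanced_two_pow_le _ _ (card_le_card inter_subset_left)).2 ?_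
  have := hC.two_pow_add_le_card_boundaryFiber hT he
  rwa [h _ (by simpa using he), card_singleton] at this

/-- The vertices `p 0, …, p m` are the non-pendant ones and form a path, with all pendant vertices
attached to its ends. -/
structure IsSpine {V : Type*} (T : SimpleGraph V) {m : ℕ} (p : Fin (m + 1) → V) : Prop where
  injective : Function.Injective p
  not_isPendant : ∀ i, ¬T.IsPendant (p i)
  surjective : ∀ v, ¬T.IsPendant v → ∃ i, p i = v
  adj_iff : ∀ i j, T.Adj (p i) (p j) ↔ i.val + 1 = j.val ∨ j.val + 1 = i.val
  adj_end : ∀ l, T.IsPendant l → T.Adj l (p 0) ∨ T.Adj l (p (Fin.last m))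

omit [Fintype V] in
lemma IsSpine.rev {m : ℕ} {p : Fin (m + 1) → V} (hp : T.IsSpine p) :
    T.IsSpine (p ∘ Fin.rev) where
  injective := hp.injective.comp Fin.rev_injective
  not_isPendant i := hp.not_isPendant _
  surjective v hv := by
    obtain ⟨i, hi⟩ := hp.surjective v hv
    exact ⟨i.rev, by simpa using hi⟩
  adj_iff i j := by
    have := i.2
    have := j.2
    simp only [Function.comp_apply, hp.adj_iff, Fin.val_rev]
    omega
  adj_end l hl := by
    simpa [Fin.rev_last] using (hp.adj_end l hl).symm

/-- A tree in which a vertex with two non-pendant neighbours has no further neighbours has a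
spine. -/
lemma IsTree.exists_isSpine (hT : T.IsTree) (hV : 3 ≤ Fintype.card V)
    (hleaf : T.leafSet.Nonempty)
    (h : ∀ v w₁ w₂ w₃ : V, ¬T.IsPendant v → ¬T.IsPendant w₁ → ¬T.IsPendant w₂ →
      T.Adj v w₁ → T.Adj v w₂ → w₁ ≠ w₂ → T.Adj v w₃ → w₃ = w₁ ∨ w₃ = w₂) :
    ∃ p : Fin (T.innerEdges.card + 1) → V, T.IsSpine p := by
  obtain ⟨l₀, hl₀⟩ := hleaf
  rw [mem_leafSet] at hl₀
  have hconn := hT.connected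
  have hnotadj := fun {u v : V} => not_adj_of_isPendant (u := u) (v := v) hconn hV
  obtain ⟨u, hlu, -⟩ := id hl₀
  have hu : ¬T.IsPendant u := fun hu => hnotadj hl₀ hu hlu
  -- As `u` carries the leaf `l₀`, it has at most one non-pendant neighbour: it serves as an end of
  -- the spine.
  have hu1 : ∀ v w, ¬T.IsPendant v → ¬T.IsPendant w → T.Adj u v → T.Adj u w → v = w := by
    intro v w hv hw huv huw
    by_contra hne
    rcases h u v w l₀ hu hv hw huv huw hne hlu.symm with rfl | rfl
    · exact hv hl₀
    · exact hw hl₀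
  have hstep : ∀ w, w ≠ u → ∃ z, T.Adj z w ∧ T.dist u z + 1 = T.dist u w := by
    intro w hw
    obtain ⟨q, hq⟩ := hconn.exists_walk_length_eq_dist w u
    cases q with
    | nil => exact absurd rfl hw
    | cons hadj q =>
      refine ⟨_, hadj.symm, ?_⟩
      have h1 := T.dist_le q
      rw [dist_comm] at h1
      rw [Walk.length_cons, dist_comm] at hq
      rcases hT.dist_eq_dist_add_one_of_adj u hadj with h2 | h2 <;> omega
  have hparent : ∀ w, ¬T.IsPendant w → w ≠ u →
      ∃ z, ¬T.IsPendant z ∧ T.Adj z w ∧ T.dist u z + 1 = T.dist u w := by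
    intro w hw hwu
    obtain ⟨z, hzw, hz⟩ := hstep w hwu
    refine ⟨z, fun hzp => ?_, hzw, hz⟩
    obtain ⟨y, hyz, hy⟩ := hstep z (by rintro rfl; exact hu hzp)
    have := hzp.unique hyz.symm hzw
    subst this
    omega
  have hzero : ∀ w, T.dist u w = 0 → w = u := fun w hw => (hconn.dist_eq_zero_iff.1 hw).symm
  -- Distance from `u` separates non-pendant vertices: two at the same level share a parent, which
  -- already has its own parent as a neighbour unless it is `u`.
  have hinj : ∀ n v w, ¬T.IsPendant v → ¬T.IsPendant w → T.dist u v = n → T.dist u w = n →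
      v = w := by
    intro n
    induction n with
    | zero => exact fun v w _ _ h1 h2 => (hzero v h1).trans (hzero w h2).symm
    | succ n ih =>
      intro v w hv hw h1 h2
      obtain ⟨z, hz, hzv, hdz⟩ := hparent v hv (by rintro rfl; simp at h1)
      obtain ⟨z', hz', hzw, hdz'⟩ := hparent w hw (by rintro rfl; simp at h2)
      obtain rfl := ih z z' hz hz' (by omega) (by omega)
      by_cases hzu : z = u
      · subst hzu
        exact hu1 v w hv hw hzv hzw
      · obtain ⟨y, hy, hyz, hdy⟩ := hparent z hz hzu
        rcases h z y v w hz hy hv hyz.symm hzv (by rintro rfl; omega) hzw with rfl | rfl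
        · omega
        · rfl
  have hdown : ∀ n w, ¬T.IsPendant w → T.dist u w = n → ∀ j ≤ n,
      ∃ v, ¬T.IsPendant v ∧ T.dist u v = j := by
    intro n
    induction n with
    | zero => exact fun w hw h1 j hj => ⟨w, hw, by omega⟩
    | succ n ih =>
      intro w hw h1 j hj
      rcases hj.eq_or_lt with rfl | hj
      · exact ⟨w, hw, h1⟩
      · obtain ⟨z, hz, -, hdz⟩ := hparent w hw (by rintro rfl; simp at h1)
        exact ih z hz (by omega) j (by omega)
  let I : Finset V := univ.filter fun v => ¬T.IsPendant v
  have hI : ∀ v, v ∈ I ↔ ¬T.IsPendant v := fun v => by simp [I]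
  have hIcard : I.card = T.innerEdges.card + 1 := by
    have h1 := hT.card_innerEdges hV
    have h2 := card_filter_add_card_filter_not (s := (univ : Finset V)) T.IsPendant
    rw [card_univ] at h2
    change T.leafSet.card + I.card = _ at h2
    omega
  obtain ⟨w, hwI, hwmax⟩ := I.exists_max_image (T.dist u) ⟨u, (hI u).2 hu⟩
  have himage : I.image (T.dist u) = range (T.dist u w + 1) := by
    ext j
    rw [mem_image, mem_range, Nat.lt_succ_iff]
    constructor
    · rintro ⟨v, hv, rfl⟩
      exact hwmax v hv
    · intro hj
      obtain ⟨v, hv, hvj⟩ := hdown _ w ((hI w).1 hwI) rfl j hj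
      exact ⟨v, (hI v).2 hv, hvj⟩
  have hM : T.dist u w = T.innerEdges.card := by
    have h1 : (I.image (T.dist u)).card = I.card := card_image_of_injOn fun v hv v' hv' hvv =>
      hinj _ v v' ((hI v).1 hv) ((hI v').1 hv') rfl hvv.symm
    rw [himage, card_range, hIcard] at h1
    omega
  have hex : ∀ i : Fin (T.innerEdges.card + 1), ∃ v, ¬T.IsPendant v ∧ T.dist u v = i.val :=
    fun i => hdown _ w ((hI w).1 hwI) hM i (Nat.lt_succ_iff.1 i.2)
  choose p hp hdp using hex
  refine ⟨p, fun i j hij => Fin.ext (by rw [← hdp, ← hdp, hij]), hp, fun v hv => ?_,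
    fun i j => ?_, fun l hl => ?_⟩
  · have hle := hwmax v ((hI v).2 hv)
    exact ⟨⟨T.dist u v, by omega⟩, hinj _ _ _ (hp _) hv (hdp _) rfl⟩
  · have key : ∀ i j, i.val + 1 = j.val → T.Adj (p i) (p j) := by
      intro i j hij
      obtain ⟨z, hz, hzj, hdz⟩ := hparent (p j) (hp j) (by
        intro h0
        have := hdp j
        rw [h0, dist_self] at this
        omega)
      rw [hinj _ (p i) z (hp i) hz (hdp i) (by have := hdp j; omega)]
      exact hzj
    refine ⟨fun hij => ?_, ?_⟩
    · have h1 := hT.dist_eq_dist_add_one_of_adj u hij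
      rw [hdp, hdp] at h1
      omega
    · rintro (hij | hij)
      · exact key i j hij
      · exact (key j i hij).symm
  · obtain ⟨z, hlz, -⟩ := id hl
    have hz : ¬T.IsPendant z := fun hz => hnotadj hl hz hlz
    have hle := hwmax z ((hI z).2 hz)
    by_cases h0 : T.dist u z = 0
    · refine Or.inl ?_
      rwa [hinj _ (p 0) z (hp 0) hz (hdp 0) h0]
    · by_cases hlast : T.dist u z = T.innerEdges.card
      · refine Or.inr ?_
        rwa [hinj _ (p (Fin.last _)) z (hp _) hz (hdp _) hlast]
      -- An interior spine vertex has its parent and its child as non-pendant neighbours, so the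
      -- leaf `l` would be a third neighbour.
      · exfalso
        obtain ⟨y, hy, hyz, hdy⟩ := hparent z hz (by rintro rfl; simp at h0)
        let j : Fin (T.innerEdges.card + 1) := ⟨T.dist u z + 1, by omega⟩
        obtain ⟨z', hz', hzj, hdz⟩ := hparent (p j) (hp j) (by
          intro h0
          have := hdp j
          rw [h0, dist_self] at this
          simp [j] at this)
        have hdj : T.dist u (p j) = T.dist u z + 1 := hdp j
        rw [hinj _ z' z hz' hz rfl (by omega)] at hzj
        rcases h z y (p j) l hz hy (hp j) hyz.symm hzj
          (fun hyj => by rw [hyj] at hdy; omega) hlz.symm with rfl | rfl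
        · exact hy hl
        · exact hp j hl

lemma IsSpine.nonempty_iso {m : ℕ} {p : Fin (m + 1) → V} (hp : T.IsSpine p) (hm : 1 ≤ m)
    {a b : ℕ} (ha : (T.leafSet.filter fun l => T.Adj l (p 0)).card = a)
    (hb : (T.leafSet.filter fun l => T.Adj l (p (Fin.last m))).card = b) :
    Nonempty (T ≃g doubleBroom a b (m + 1)) := by
  let eA := (Finset.equivFinOfCardEq ha).symm
  let eB := (Finset.equivFinOfCardEq hb).symm
  let q : Fin a ⊕ Fin b → V := Sum.elim (fun s => (eA s).1) (fun s => (eB s).1)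
  have hA : ∀ s, T.IsPendant (eA s).1 ∧ T.Adj (eA s).1 (p 0) := fun s => by
    simpa using (mem_filter.1 (eA s).2)
  have hB : ∀ s, T.IsPendant (eB s).1 ∧ T.Adj (eB s).1 (p (Fin.last m)) := fun s => by
    simpa using (mem_filter.1 (eB s).2)
  have hends : p 0 ≠ p (Fin.last m) := fun h => by
    have := congrArg Fin.val (hp.injective h)
    simp at this
    omega
  have hqpend : ∀ l, T.IsPendant (q l) := by
    rintro (s | s)
    · exact (hA s).1
    · exact (hB s).1
  have hqfoot : ∀ l, T.Adj (q l) (p (broomFoot a b m l)) := by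
    rintro (s | s)
    · exact (hA s).2
    · exact (hB s).2
  have hqadj : ∀ l x, T.Adj (q l) x ↔ x = p (broomFoot a b m l) := fun l x =>
    ⟨fun h => (hqpend l).unique h (hqfoot l), fun h => h ▸ hqfoot l⟩
  have hqinj : Function.Injective q := by
    rintro (s | s) (t | t) hst
    · exact congrArg Sum.inl (eA.injective (Subtype.ext hst))
    · exact absurd ((hA s).1.unique (hA s).2 (by
        rw [show (eA s).1 = (eB t).1 from hst]
        exact (hB t).2)) hends
    · exact absurd ((hA t).1.unique (hA t).2 (by
        rw [show (eA t).1 = (eB s).1 from hst.symm]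
        exact (hB s).2)) hends
    · exact congrArg Sum.inr (eB.injective (Subtype.ext hst))
  have hinj : Function.Injective (Sum.elim p q) := by
    rintro (s | s) (t | t) hst
    · exact congrArg Sum.inl (hp.injective hst)
    · exact absurd (hqpend t) (by rw [show q t = p s from hst.symm]; exact hp.not_isPendant s)
    · exact absurd (hqpend s) (by rw [show q s = p t from hst]; exact hp.not_isPendant t)
    · exact congrArg Sum.inr (hqinj hst)
  have hsurj : Function.Surjective (Sum.elim p q) := by
    intro v
    by_cases hv : T.IsPendant v
    · rcases hp.adj_end v hv with h | h
      · obtain ⟨s, hs⟩ := eA.surjective ⟨v, by simp [hv, h]⟩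
        exact ⟨.inr (.inl s), congrArg Subtype.val hs⟩
      · obtain ⟨s, hs⟩ := eB.surjective ⟨v, by simp [hv, h]⟩
        exact ⟨.inr (.inr s), congrArg Subtype.val hs⟩
    · obtain ⟨i, hi⟩ := hp.surjective v hv
      exact ⟨.inl i, hi⟩
  have hleaf : ∀ l x, T.Adj (Sum.elim p q (.inr l)) (Sum.elim p q x) ↔
      (doubleBroom a b (m + 1)).Adj (.inr l) x := by
    intro l x
    rw [doubleBroom_adj_inr_iff, ← hinj.eq_iff]
    exact hqadj l _
  let e : doubleBroom a b (m + 1) ≃g T :=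
    { toEquiv := Equiv.ofBijective (Sum.elim p q) ⟨hinj, hsurj⟩
      map_rel_iff' := by
        rintro (x | x) (y | y)
        · exact hp.adj_iff x y
        · exact (adj_comm _ _ _).trans ((hleaf y (.inl x)).trans (adj_comm _ _ _))
        · exact hleaf x (.inl y)
        · exact hleaf x (.inr y) }
  exact ⟨e.symm⟩

/-- All later spine vertices stay on the side of `p 1`, and each leaf lies on the side of its
neighbour. -/
lemma IsSpine.leafSet_inter_cut {m : ℕ} {p : Fin (m + 1) → V} (hp : T.IsSpine p) (hm : 1 ≤ m)
    {C : Finset V} (hC : T.IsCut s(p 0, p 1) C) (h0 : p 0 ∈ C) (h1 : p 1 ∉ C) :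
    T.leafSet ∩ C = T.leafSet.filter fun l => T.Adj l (p 0) := by
  -- The numeral is read modulo `m + 1`; `1 ≤ m` prevents it from wrapping to `0`.
  have hval1 : (1 : Fin (m + 1)).val = 1 := by
    rw [Fin.val_one']
    exact Nat.mod_eq_of_lt (by omega)
  have hsame : ∀ {x y}, T.Adj x y → s(x, y) ≠ s(p 0, p 1) → (x ∈ C ↔ y ∈ C) := by
    intro x y hxy hne
    by_contra h
    exact hne ((hC hxy).1 (by simpa using h))
  have hleaf : ∀ {l i}, T.IsPendant l → T.Adj l (p i) → (l ∈ C ↔ p i ∈ C) := by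
    intro l i hl hli
    refine hsame hli fun h => ?_
    rcases Sym2.eq_iff.1 h with ⟨rfl, -⟩ | ⟨rfl, -⟩ <;> exact hp.not_isPendant _ hl
  have hout : ∀ n (hn : n < m + 1), 1 ≤ n → p ⟨n, hn⟩ ∉ C := by
    intro n hn h
    induction n, h using Nat.le_induction with
    | base => rwa [show (⟨1, hn⟩ : Fin (m + 1)) = 1 from Fin.ext hval1.symm]
    | succ n h1n ih =>
      have hadj : T.Adj (p ⟨n, by omega⟩) (p ⟨n + 1, hn⟩) := (hp.adj_iff _ _).2 (Or.inl rfl)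
      rw [← hsame hadj fun h => ?_]
      · exact ih _
      · rcases Sym2.eq_iff.1 h with ⟨h, -⟩ | ⟨-, h⟩
        · have := congrArg Fin.val (hp.injective h)
          simp at this
          omega
        · have := congrArg Fin.val (hp.injective h)
          simp at this
  ext l
  rw [mem_inter, mem_filter, mem_leafSet]
  refine and_congr_right fun hl => ⟨fun hlC => ?_, fun h => (hleaf hl h).2 h0⟩
  rcases hp.adj_end l hl with h | h
  · exact h
  · exact absurd ((hleaf hl h).1 hlC) (hout m _ hm)

lemma IsSpine.card_ends_add {m : ℕ} {p : Fin (m + 1) → V} (hp : T.IsSpine p) (hm : 1 ≤ m) :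
    (T.leafSet.filter fun l => T.Adj l (p 0)).card +
      (T.leafSet.filter fun l => T.Adj l (p (Fin.last m))).card = T.leafSet.card := by
  rw [← card_filter_add_card_filter_not (s := T.leafSet) (fun l => T.Adj l (p 0))]
  congr 2
  refine filter_congr fun l hl => ?_
  rw [mem_leafSet] at hl
  refine ⟨fun h h' => ?_, fun h => (hp.adj_end l hl).resolve_left h⟩
  have := congrArg Fin.val (hp.injective (hl.unique h' h))
  simp at this
  omega

lemma IsTree.nonempty_iso_of_tight (hT : T.IsTree) (hV : 3 ≤ Fintype.card V)
    (hleaf : T.leafSet.Nonempty) (hm : 1 ≤ T.innerEdges.card)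
    (h : (connSets T).card ≤ broomCount T.leafSet.card T.innerEdges.card) :
    Nonempty (T ≃g doubleBroom (T.leafSet.card / 2) ((T.leafSet.card + 1) / 2)
      (T.innerEdges.card + 1)) := by
  have htight := fun P hP => hT.card_boundaryFiber_eq hV h (P := P) hP
  obtain ⟨p, hp⟩ := hT.exists_isSpine hV hleaf fun v w₁ w₂ w₃ => eq_or_eq_of_tight htight
  have hadj : T.Adj (p 0) (p 1) := by
    rw [hp.adj_iff, Fin.val_one', Fin.val_zero, Nat.mod_eq_of_lt (by omega)]
    exact Or.inl rfl
  obtain ⟨C, h0, h1, hC⟩ := hT.isAcyclic.exists_isCut hadj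
  have hC' : T.IsCut s(p 0, p 1) (C.toFinset : Set V) := by simpa using hC
  have hcard := hC'.card_leaves_eq_of_tight hT.connected htight
    (mk_mem_innerEdges.2 ⟨hadj, hp.not_isPendant _, hp.not_isPendant _⟩)
  rw [hp.leafSet_inter_cut hm hC' (by simpa using h0) (by simpa using h1)] at hcard
  have hsum := hp.card_ends_add hm
  rcases hcard with hcard | hcard
  · exact hp.nonempty_iso hm hcard (by omega)
  -- The larger half sits at `p 0`; reversing the spine puts the smaller half first.
  · refine hp.rev.nonempty_iso hm ?_ ?_
    · simp only [Function.comp_apply, Fin.rev_zero]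
      omega
    · simp only [Function.comp_apply, Fin.rev_last]
      omega

end Equality

end SimpleGraph

/-! ### Assembly through a spanning tree -/

open SimpleGraph in
theorem theorem5p5 {V : Type*} [Fintype V] (G : SimpleGraph V) [DecidableRel G.Adj]
    (n k : ℕ) (hk : 2 ≤ k) (hkn : k + 2 ≤ n)
    (hn : Fintype.card V = n) (hG : G.Connected)
    (hpendant : (Finset.univ.filter (fun v : V => G.degree v = 1)).card = k) :
    coreIndex (doubleBroom (k / 2) ((k + 1) / 2) (n - k)) ≤ coreIndex G ∧
      (coreIndex G = coreIndex (doubleBroom (k / 2) ((k + 1) / 2) (n - k)) ↔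
        Nonempty (G ≃g doubleBroom (k / 2) ((k + 1) / 2) (n - k))) := by
  have hV : 3 ≤ Fintype.card V := by omega
  have hGk : G.leafSet.card = k := by
    rw [← hpendant]
    congr 1
    ext v
    simp [leafSet, IsPendant, degree_eq_one_iff_existsUnique_adj]
  obtain ⟨m, hm⟩ : ∃ m, n = k + m + 1 := ⟨n - k - 1, by omega⟩
  have hnk : n - k = m + 1 := by omega
  have hbroom : coreIndex (doubleBroom (k / 2) ((k + 1) / 2) (n - k)) ≤ broomCount k m := by
    rw [hnk]
    refine coreIndex_doubleBroom_le.trans (le_of_eq ?_)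
    rw [show k / 2 + (k + 1) / 2 = k by omega, broomCount]
  obtain ⟨T, hTG, hT⟩ := hG.exists_isTree_le
  have hleaves : k ≤ T.leafSet.card := by
    rw [← hGk]
    refine Finset.card_le_card fun v hv => ?_
    rw [mem_leafSet] at hv ⊢
    obtain ⟨w, hw, huniq⟩ := hv
    have : Nontrivial V := Fintype.one_lt_card_iff_nontrivial.1 (by omega)
    obtain ⟨w', hw'⟩ := hT.connected.preconnected.exists_adj_of_nontrivial v
    exact ⟨w', hw', fun y hy => (huniq y (hTG hy)).trans (huniq w' (hTG hw')).symm⟩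
  have hcard := hT.card_innerEdges hV
  have hbound : broomCount k m ≤ (connSets T).card := by
    refine le_trans ?_ (hT.broomCount_le hV)
    obtain ⟨j, hj⟩ := Nat.exists_eq_add_of_le hleaves
    rw [hj, show m = T.innerEdges.card + j by omega]
    exact broomCount_add_le _ _ _
  refine ⟨hbroom.trans (hbound.trans (card_connSets_le hTG)), fun heq => ?_,
    fun ⟨e⟩ => coreIndex_eq_of_iso e⟩
  have hTG' : T = G := by
    by_contra hne
    have := card_connSets_lt hTG hne hG
    omega
  subst hTG'
  have hle := card_connSets_le (le_refl T)
  -- Now `T` is `G`, so it has exactly `k` leaves and no inner edge was traded away.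
  have hinner : T.innerEdges.card = m := by omega
  have hiso := hT.nonempty_iso_of_tight hV (Finset.card_pos.1 (by omega)) (by omega)
    (by rw [hGk, hinner]; omega)
  rwa [hGk, hinner, ← hnk] at hiso
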